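/- Let $\mathbb X,\mathbb Y$ be real or complex Hilbert spaces, $\Omega\subseteq\mathbb X$ an open set, $J:\mathbb X\to\mathbb R\cup\{+\infty\}$ a proper convex functional that is lower semicontinuous at every point of $\Omega$ (in particular $J$ may be a functional given on a convex $\Omega$ and extended by $+\infty$), and $F:\Omega\to\mathbb Y$ a continuously differentiable function such that $F'(x)$ has closed image for every $x\in\Omega$. Let $x_*\in\Omega$, $R>0$, let $A^\dagger$ denote the Moore–Penrose inverse of a bounded operator $A$ with closed image, and put $$\beta:=\|F'(x_*)^{\dagger}\|,\qquad \kappa:=\beta\,\|F'(x_*)\|,\qquad \delta:=\sup\{t\in[0,R): B(x_*,t)\subset\Omega\},\qquad \sigma(x):=\|x-x_*\|.$$ Suppose that $F(x_*)=0$, $0\in\partial J(x_*)$, $F'(x_*)$ is injective, and there is $L>0$ such that $$\beta\,\|F'(x)-F'(x_*+\tau(x-x_*))\|\le L(1-\tau)\sigma(x)\qquad\text{for all } x\in B(x_*,\delta),\ \tau\in[0,1].$$ Let $$r:=\min\left\{\frac{4+\kappa-\sqrt{(4+\kappa)^2-8}}{2L},\ \delta\right\}.$$ For $H(x)=F'(x)^*F'(x)$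 let $\mathrm{prox}_J^{H(x)}(z)$ be the minimizer over $y\in\mathbb X$ of $J(y)+\tfrac12\langle y-z,H(x)(y-z)\rangle$. Then, for every $x_0\in B(x_*,r)\setminus\{x_*\}$, the proximal Gauss–Newton iteration $$x_{k+1}=\mathrm{prox}_J^{H(x_k)}\bigl(x_k-F'(x_k)^\dagger F(x_k)\bigr),\qquad k=0,1,\dots,$$ is well defined (for every $k$: $x_k\in\Omega$, $F'(x_k)^\dagger$ exists and is unique, $H(x_k)$ is invertible, and the minimization problem defining $x_{k+1}$ has exactly one solution), the sequence $\{x_k\}$ is contained in $B(x_*,r)$, converges to $x_*$, and $$\|x_{k+1}-x_*\|\le\frac{\kappa L+L^2\sigma(x_0)}{2[1-L\sigma(x_0)]^2}\,\|x_k-x_*\|^2\qquad\text{for all } k=0,1,\dots.$$ -/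

import Mathlib

open Filter Topology

noncomputable section

namespace ProxGN

section Functional

variable (𝕜 : Type*) {X : Type*} [RCLike 𝕜] [NormedAddCommGroup X] [InnerProductSpace 𝕜 X]

/-- `J : X → ℝ ∪ {+∞}` is proper: it never takes the value `-∞` and is finite somewhere. -/
def ProperFun (J : X → EReal) : Prop :=
  (∀ x, J x ≠ ⊥) ∧ ∃ x, J x ≠ ⊤

/-- Convexity of an extended-real-valued functional (real convex combinations; the coefficients
are taken positive, so that `0 * ⊤` never occurs). -/
def ConvexFun (J : X → EReal) : Prop :=
  ∀ x y : X, ∀ a b : ℝ, 0 < a → 0 < b → a + b = 1 →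
    J ((a : 𝕜) • x + (b : 𝕜) • y) ≤ (a : EReal) * J x + (b : EReal) * J y

/-- The convex subdifferential `∂J(x)`. -/
def subdifferential (J : X → EReal) (x : X) : Set X :=
  {u | ∀ y, J x + ((RCLike.re (inner 𝕜 u (y - x)) : ℝ) : EReal) ≤ J y}

/-- The functional `x ↦ J(x) + ½ ‖x - z‖²_H`, where `‖v‖²_H = ⟨v, H v⟩`. -/
def proxObjective (J : X → EReal) (H : X →L[𝕜] X) (z x : X) : EReal :=
  J x + ((1 / 2 * RCLike.re (inner 𝕜 (x - z) (H (x - z))) : ℝ) : EReal)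

/-- `p` minimizes `x ↦ J(x) + ½ ‖x - z‖²_H` over the whole space. -/
def IsProx (J : X → EReal) (H : X →L[𝕜] X) (z p : X) : Prop :=
  ∀ x, proxObjective 𝕜 J H z p ≤ proxObjective 𝕜 J H z x

open Classical in
/-- The proximity operator `prox_J^H(z)`: the minimizer of `x ↦ J(x) + ½ ‖x - z‖²_H`
(and `0` if there is none). -/
def prox (J : X → EReal) (H : X →L[𝕜] X) (z : X) : X :=
  if h : ∃ p, IsProx 𝕜 J H z p then h.choose else 0

end Functional

section Operators

variable {𝕜 X Y : Type*} [RCLike 𝕜]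
  [NormedAddCommGroup X] [InnerProductSpace 𝕜 X] [CompleteSpace X]
  [NormedAddCommGroup Y] [InnerProductSpace 𝕜 Y] [CompleteSpace Y]

/-- The four Penrose equations: `B` is the Moore–Penrose inverse of `A`. -/
structure IsMoorePenrose (A : X →L[𝕜] Y) (B : Y →L[𝕜] X) : Prop where
  mul_mul_left : A ∘L B ∘L A = A
  mul_mul_right : B ∘L A ∘L B = B
  adjoint_left : ContinuousLinearMap.adjoint (A ∘L B) = A ∘L B
  adjoint_right : ContinuousLinearMap.adjoint (B ∘L A) = B ∘L A

open Classical in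
/-- The Moore–Penrose inverse `A†` (and `0` if there is none). -/
def pinv (A : X →L[𝕜] Y) : Y →L[𝕜] X :=
  if h : ∃ B, IsMoorePenrose A B then h.choose else 0

variable (𝕜)

/-- `H(x) = F'(x)* F'(x)`. -/
def gaussNewtonMetric (F : X → Y) (x : X) : X →L[𝕜] X :=
  ContinuousLinearMap.adjoint (fderiv 𝕜 F x) ∘L fderiv 𝕜 F x

/-- The Gauss–Newton point `x - F'(x)† F(x)`. -/
def gaussNewtonPoint (F : X → Y) (x : X) : X :=
  x - pinv (fderiv 𝕜 F x) (F x)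

/-- The proximal Gauss–Newton iterates
`x₍ₖ₊₁₎ = prox_J^{H(xₖ)} (xₖ - F'(xₖ)† F(xₖ))` started at `x₀`. -/
def proxGaussNewton (F : X → Y) (J : X → EReal) (x₀ : X) : ℕ → X
  | 0 => x₀
  | k + 1 =>
    let x := proxGaussNewton F J x₀ k
    prox 𝕜 J (gaussNewtonMetric 𝕜 F x) (gaussNewtonPoint 𝕜 F x)

/-- The proximal Gauss–Newton step at `x` makes sense: `x` lies in the domain `Ω` of `F`, the
Moore–Penrose inverse of `F'(x)` exists and is unique, the positive operator `H(x)` is boundedly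
invertible, and the minimization problem that defines the next iterate has exactly one solution. -/
structure StepWellDefined (F : X → Y) (Ω : Set X) (J : X → EReal) (x : X) : Prop where
  mem_domain : x ∈ Ω
  pinv_exists : ∃! B, IsMoorePenrose (fderiv 𝕜 F x) B
  metric_invertible : IsUnit (gaussNewtonMetric 𝕜 F x)
  prox_exists : ∃! p, IsProx 𝕜 J (gaussNewtonMetric 𝕜 F x) (gaussNewtonPoint 𝕜 F x) p

end Operators

end ProxGN

end

/-! Write A = F'(x), σ = σ(x), and let z be the Gauss–Newton point. Since 0 ∈ ∂J(x_*), x_* minimizes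
J and so is fixed by the prox in every metric; a prox does not increase the distance to such a point
in its own metric, so the next iterate p satisfies ‖A(p - x_*)‖ ≤ ‖A(z - x_*)‖. As A† is a left
inverse of A and AA† is a contraction, the right side is at most the linearization error Lσ²/(2β).
Perturbing ‖v‖ ≤ β‖F'(x_*)v‖ gives (1 - Lσ)/β · ‖v‖ ≤ ‖Av‖. Hence ‖p - x_*‖ ≤ Lσ²/(2(1 - Lσ)): β
cancels, κ ≥ 1 makes this stronger than the claim, and Lr ≤ 1/2 makes each step at least halve the
error.

The delicate point is that J is semicontinuous only on Ω: the limit of a minimizing sequence must be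
located in Ω before semicontinuity is used. `exists_minimizer_of_bounded_below` does this;
`stepWellDefined_and_norm_prox_sub_le` assembles one step. -/

namespace ProxGN

/-! ### Convex combinations and the parallelogram identity -/

section ConvexCombination

variable {𝕜 E G : Type*} [RCLike 𝕜] [NormedAddCommGroup E] [InnerProductSpace 𝕜 E]
  [NormedAddCommGroup G] [InnerProductSpace 𝕜 G]

theorem norm_sq_convexCombination (u v : E) {a b : ℝ} (hab : a + b = 1) :
    ‖(a : 𝕜) • u + (b : 𝕜) • v‖ ^ 2 =
      a * ‖u‖ ^ 2 + b * ‖v‖ ^ 2 - a * b * ‖u - v‖ ^ 2 := by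
  have h1 := @norm_add_sq 𝕜 E _ _ _ ((a : 𝕜) • u) ((b : 𝕜) • v)
  have h2 := @norm_sub_sq 𝕜 E _ _ _ u v
  rw [inner_smul_left, inner_smul_right, RCLike.conj_ofReal, RCLike.re_ofReal_mul,
    RCLike.re_ofReal_mul, norm_smul, norm_smul, RCLike.norm_ofReal, RCLike.norm_ofReal,
    mul_pow, mul_pow, sq_abs, sq_abs] at h1
  rw [h1, h2]
  obtain rfl : b = 1 - a := by linarith
  ring

theorem map_convexCombination_sub (A : E →L[𝕜] G) (x y z : E) {a b : ℝ} (hab : a + b = 1) :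
    A ((a : 𝕜) • x + (b : 𝕜) • y - z) = (a : 𝕜) • A (x - z) + (b : 𝕜) • A (y - z) := by
  rw [← map_smul, ← map_smul, ← map_add]
  congr 1
  have : z = ((a : 𝕜) + (b : 𝕜)) • z := by
    rw [← RCLike.ofReal_add, hab]; simp
  rw [smul_sub, smul_sub]
  conv_lhs => rw [this, add_smul]
  abel

end ConvexCombination

/-! ### Strongly convex minimization with local semicontinuity -/

section RealMinimization

variable {𝕜 X Y : Type*} [RCLike 𝕜]
  [NormedAddCommGroup X] [InnerProductSpace 𝕜 X] [CompleteSpace X]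
  [NormedAddCommGroup Y] [InnerProductSpace 𝕜 Y]

/-- Minimization of a convex function `j` on `D` plus `½ ‖A (· - z)‖²`. The function `j` has
a minimizer `xs`, and semicontinuity is only assumed near `xs`. -/
theorem exists_minimizer_of_bounded_below
    {D : Set X} {j : X → ℝ}
    (hconv : ∀ x ∈ D, ∀ y ∈ D, ∀ a b : ℝ, 0 < a → 0 < b → a + b = 1 →
      (a : 𝕜) • x + (b : 𝕜) • y ∈ D ∧ j ((a : 𝕜) • x + (b : 𝕜) • y) ≤ a * j x + b * j y)
    {xs : X} (hxs : xs ∈ D) (hmin : ∀ y ∈ D, j xs ≤ j y)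
    (A : X →L[𝕜] Y) {c : ℝ} (hc : 0 < c) (hA : ∀ v, c * ‖v‖ ≤ ‖A v‖) (z : X)
    (hlsc : ∀ p, ‖A (p - xs)‖ ≤ ‖A (z - xs)‖ → ∀ y : ℕ → X, (∀ n, y n ∈ D) →
      Tendsto y atTop (𝓝 p) → ∀ (g : ℕ → ℝ) (l : ℝ), (∀ n, j (y n) ≤ g n) →
      Tendsto g atTop (𝓝 l) → p ∈ D ∧ j p ≤ l) :
    ∃ p ∈ D, ‖A (p - xs)‖ ≤ ‖A (z - xs)‖ ∧
      (∀ y ∈ D, j p + 1 / 2 * ‖A (p - z)‖ ^ 2 ≤ j y + 1 / 2 * ‖A (y - z)‖ ^ 2) ∧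
      ∀ q ∈ D, (∀ y ∈ D, j q + 1 / 2 * ‖A (q - z)‖ ^ 2 ≤ j y + 1 / 2 * ‖A (y - z)‖ ^ 2) →
        q = p := by
  set Φ : X → ℝ := fun y => j y + 1 / 2 * ‖A (y - z)‖ ^ 2 with hΦ
  have hbdd : BddBelow (Φ '' D) := by
    refine ⟨j xs, ?_⟩
    rintro _ ⟨y, hy, rfl⟩
    have := hmin y hy
    simp only [hΦ]
    have : 0 ≤ 1 / 2 * ‖A (y - z)‖ ^ 2 := by positivity
    linarith
  set m : ℝ := sInf (Φ '' D) with hm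
  have hmle : ∀ y ∈ D, m ≤ Φ y := fun y hy => csInf_le hbdd ⟨y, hy, rfl⟩
  -- Strong convexity of Φ in the seminorm ‖A ·‖, supplied by the quadratic term.
  have hstrong : ∀ x ∈ D, ∀ y ∈ D, ∀ a b : ℝ, 0 < a → 0 < b → a + b = 1 →
      m ≤ a * Φ x + b * Φ y - 1 / 2 * (a * b * ‖A (x - y)‖ ^ 2) := by
    intro x hx y hy a b ha hb hab
    obtain ⟨h1, h2⟩ := hconv x hx y hy a b ha hb hab
    have h3 := hmle _ h1
    simp only [hΦ] at h3 ⊢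
    rw [map_convexCombination_sub A x y z hab, norm_sq_convexCombination _ _ hab, ← map_sub,
      sub_sub_sub_cancel_right] at h3
    linarith
  have hdist : ∀ x ∈ D, ∀ y ∈ D, ‖A (x - y)‖ ^ 2 ≤ 4 * ((Φ x - m) + (Φ y - m)) := by
    intro x hx y hy
    have := hstrong x hx y hy (1 / 2) (1 / 2) (by norm_num) (by norm_num) (by norm_num)
    linarith
  have hex : ∀ n : ℕ, ∃ y ∈ D, Φ y < m + 1 / ((n : ℝ) + 1) := by
    intro n
    have hpos : (0 : ℝ) < 1 / ((n : ℝ) + 1) := by positivity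
    obtain ⟨_, ⟨y, hy, rfl⟩, h⟩ :=
      exists_lt_of_csInf_lt (⟨_, ⟨xs, hxs, rfl⟩⟩ : (Φ '' D).Nonempty) (lt_add_of_pos_right m hpos)
    exact ⟨y, hy, h⟩
  choose y hyD hy using hex
  have hε : Tendsto (fun n : ℕ => 1 / ((n : ℝ) + 1)) atTop (𝓝 0) :=
    tendsto_one_div_add_atTop_nhds_zero_nat
  have hcauchy : CauchySeq y := by
    refine cauchySeq_of_le_tendsto_0 (fun n : ℕ => √(8 * (1 / ((n : ℝ) + 1))) / c) ?_ ?_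
    · intro n k N hn hk
      have h1 := hdist _ (hyD n) _ (hyD k)
      have h2 := hy n
      have h3 := hy k
      have h4 : 1 / ((n : ℝ) + 1) ≤ 1 / ((N : ℝ) + 1) := Nat.one_div_le_one_div hn
      have h5 : 1 / ((k : ℝ) + 1) ≤ 1 / ((N : ℝ) + 1) := Nat.one_div_le_one_div hk
      rw [dist_eq_norm, le_div_iff₀ hc, mul_comm]
      refine (hA _).trans (Real.le_sqrt_of_sq_le ?_)
      linarith
    · have h := ((hε.const_mul 8).sqrt).div_const c
      simpa using h
  obtain ⟨p, hp⟩ := cauchySeq_tendsto_of_complete hcauchy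
  have hAcont : ∀ w : X, Tendsto (fun n => ‖A (y n - w)‖ ^ 2) atTop (𝓝 (‖A (p - w)‖ ^ 2)) :=
    fun w => (((A.continuous.tendsto _).comp (hp.sub_const w)).norm).pow 2
  have hjm : j xs ≤ m := by
    refine le_csInf ⟨_, ⟨xs, hxs, rfl⟩⟩ ?_
    rintro _ ⟨y, hy, rfl⟩
    have := hmin y hy
    have : 0 ≤ 1 / 2 * ‖A (y - z)‖ ^ 2 := by positivity
    simp only [hΦ]
    linarith
  -- This uses strong convexity along segments from `y n` to `xs`, and no semicontinuity: let n → ∞,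
  -- divide by the weight t, then let t → 0.
  have hpxs : ‖A (p - xs)‖ ≤ ‖A (z - xs)‖ := by
    have hlim : ∀ t : ℝ, 0 < t → t < 1 →
        1 / 2 * ((1 - t) * ‖A (p - xs)‖ ^ 2) ≤ Φ xs - m := by
      intro t ht0 ht1
      have hn : ∀ n : ℕ, t * (1 / 2 * ((1 - t) * ‖A (y n - xs)‖ ^ 2)) ≤
          (1 - t) * (1 / ((n : ℝ) + 1)) + t * (Φ xs - m) := by
        intro n
        have h1 := hstrong _ (hyD n) _ hxs (1 - t) t (by linarith) ht0 (by ring)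
        have h2 := mul_le_mul_of_nonneg_left (hy n).le (by linarith : 0 ≤ 1 - t)
        linarith
      have hL := (((hAcont xs).const_mul (1 - t)).const_mul (1 / 2)).const_mul t
      have hR := (hε.const_mul (1 - t)).add_const (t * (Φ xs - m))
      have h := le_of_tendsto_of_tendsto' hL hR hn
      rw [mul_zero, zero_add] at h
      exact le_of_mul_le_mul_left h ht0
    have hcont : Tendsto (fun n : ℕ => 1 / 2 * ((1 - 1 / ((n : ℝ) + 1)) * ‖A (p - xs)‖ ^ 2))
        atTop (𝓝 (1 / 2 * ((1 - 0) * ‖A (p - xs)‖ ^ 2))) :=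
      ((tendsto_const_nhds.sub hε).mul_const _).const_mul _
    have hle : 1 / 2 * ((1 - 0) * ‖A (p - xs)‖ ^ 2) ≤ Φ xs - m := by
      refine le_of_tendsto hcont ?_
      filter_upwards [eventually_gt_atTop 0] with n hn
      refine hlim _ (by positivity) ?_
      rw [div_lt_one (by positivity)]
      have : (0 : ℝ) < n := by exact_mod_cast hn
      linarith
    have hsymm : ‖A (xs - z)‖ = ‖A (z - xs)‖ := by
      rw [← neg_sub z xs, map_neg, norm_neg]
    simp only [hΦ, hsymm] at hle
    refine (pow_le_pow_iff_left₀ (norm_nonneg _) (norm_nonneg _) two_ne_zero).1 ?_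
    linarith
  -- The quadratic term is continuous, so it moves into the upper bound for `j (y n)`.
  obtain ⟨hpD, hpm⟩ := hlsc p hpxs y hyD hp
    (fun n => m + 1 / ((n : ℝ) + 1) - 1 / 2 * ‖A (y n - z)‖ ^ 2)
    (m + 0 - 1 / 2 * ‖A (p - z)‖ ^ 2)
    (fun n => by have := (hy n).le; simp only [hΦ] at this; linarith)
    ((hε.const_add m).sub ((hAcont z).const_mul _))
  have hpΦ : Φ p ≤ m := by simp only [hΦ]; linarith
  refine ⟨p, hpD, hpxs, fun y hy => hpΦ.trans (hmle y hy), fun q hq hqmin => ?_⟩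
  have h1 := hdist q hq p hpD
  have h2 : Φ q ≤ Φ p := hqmin p hpD
  have h3 : ‖A (q - p)‖ ^ 2 ≤ 0 := by linarith
  have h4 : ‖A (q - p)‖ = 0 := by nlinarith [norm_nonneg (A (q - p))]
  have h5 := hA (q - p)
  rw [h4] at h5
  have h6 : ‖q - p‖ ≤ 0 := by
    by_contra hne
    push Not at hne
    nlinarith [mul_pos hc hne]
  exact sub_eq_zero.1 (norm_le_zero_iff.1 h6)

end RealMinimization

/-! ### Proximal points of extended-real-valued functionals -/

section EReal

variable {𝕜 X Y : Type*} [RCLike 𝕜]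
  [NormedAddCommGroup X] [InnerProductSpace 𝕜 X] [CompleteSpace X]
  [NormedAddCommGroup Y] [InnerProductSpace 𝕜 Y] [CompleteSpace Y]

theorem proxObjective_adjoint_comp_self (J : X → EReal) (A : X →L[𝕜] Y) (z x : X) :
    proxObjective 𝕜 J (ContinuousLinearMap.adjoint A ∘L A) z x =
      J x + ((1 / 2 * ‖A (x - z)‖ ^ 2 : ℝ) : EReal) := by
  rw [proxObjective, ContinuousLinearMap.comp_apply, ContinuousLinearMap.adjoint_inner_right,
    inner_self_eq_norm_sq]

/-- The proximal point exists, is unique and is no farther from the minimizer `xs` of `J` than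
`z` is, in the metric `‖A ·‖`, when `J` is lower semicontinuous near `xs`. -/
theorem existsUnique_isProx {J : X → EReal} (hJ : ProperFun J) (hconv : ConvexFun 𝕜 J)
    {xs : X} (hmin : ∀ y, J xs ≤ J y)
    (A : X →L[𝕜] Y) {c : ℝ} (hc : 0 < c) (hA : ∀ v, c * ‖v‖ ≤ ‖A v‖) (z : X)
    (hlsc : ∀ p, ‖A (p - xs)‖ ≤ ‖A (z - xs)‖ → LowerSemicontinuousAt J p) :
    ∃ p, ‖A (p - xs)‖ ≤ ‖A (z - xs)‖ ∧
      IsProx 𝕜 J (ContinuousLinearMap.adjoint A ∘L A) z p ∧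
      ∀ q, IsProx 𝕜 J (ContinuousLinearMap.adjoint A ∘L A) z q → q = p := by
  obtain ⟨hbot, w, hw⟩ := hJ
  have hxs : J xs ≠ ⊤ := fun h => hw (top_le_iff.1 (h ▸ hmin w))
  have hcoe : ∀ x, J x ≠ ⊤ → ((J x).toReal : EReal) = J x :=
    fun x hx => EReal.coe_toReal hx (hbot x)
  have hobj : ∀ x, J x ≠ ⊤ → proxObjective 𝕜 J (ContinuousLinearMap.adjoint A ∘L A) z x =
      (((J x).toReal + 1 / 2 * ‖A (x - z)‖ ^ 2 : ℝ) : EReal) := by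
    intro x hx
    rw [proxObjective_adjoint_comp_self, EReal.coe_add, hcoe x hx]
  have hconv' : ∀ x ∈ {x | J x ≠ ⊤}, ∀ y ∈ {x | J x ≠ ⊤}, ∀ a b : ℝ, 0 < a → 0 < b → a + b = 1 →
      (a : 𝕜) • x + (b : 𝕜) • y ∈ {x | J x ≠ ⊤} ∧
        (J ((a : 𝕜) • x + (b : 𝕜) • y)).toReal ≤ a * (J x).toReal + b * (J y).toReal := by
    intro x hx y hy a b ha hb hab
    have h := hconv x y a b ha hb hab
    rw [← hcoe x hx, ← hcoe y hy, ← EReal.coe_mul, ← EReal.coe_mul, ← EReal.coe_add] at h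
    have hfin : J ((a : 𝕜) • x + (b : 𝕜) • y) ≠ ⊤ := fun h' =>
      EReal.coe_ne_top _ (top_le_iff.1 (h' ▸ h))
    refine ⟨hfin, ?_⟩
    rw [← hcoe _ hfin] at h
    exact_mod_cast h
  have hlsc' : ∀ p, ‖A (p - xs)‖ ≤ ‖A (z - xs)‖ → ∀ y : ℕ → X, (∀ n, y n ∈ {x | J x ≠ ⊤}) →
      Tendsto y atTop (𝓝 p) → ∀ (g : ℕ → ℝ) (l : ℝ), (∀ n, (J (y n)).toReal ≤ g n) →
      Tendsto g atTop (𝓝 l) → p ∈ {x | J x ≠ ⊤} ∧ (J p).toReal ≤ l := by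
    intro p hp y hyD hy g l hg hl
    have hle : J p ≤ (l : EReal) := by
      by_contra hlt
      push Not at hlt
      obtain ⟨b, hb1, hb2⟩ := EReal.lt_iff_exists_real_btwn.1 hlt
      have hev : ∀ᶠ n in atTop, b ≤ g n := by
        filter_upwards [hy.eventually (hlsc p hp b hb2)] with n hn
        rw [← hcoe _ (hyD n)] at hn
        exact (EReal.coe_lt_coe_iff.1 hn).le.trans (hg n)
      exact absurd (ge_of_tendsto hl hev) (not_le.2 (EReal.coe_lt_coe_iff.1 hb1))
    have hfin : J p ≠ ⊤ := fun h' => EReal.coe_ne_top _ (top_le_iff.1 (h' ▸ hle))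
    refine ⟨hfin, ?_⟩
    rw [← hcoe p hfin] at hle
    exact_mod_cast hle
  obtain ⟨p, hpD, hp, hpmin, huniq⟩ := exists_minimizer_of_bounded_below (𝕜 := 𝕜)
    (D := {x | J x ≠ ⊤}) (j := fun x => (J x).toReal) (xs := xs) hconv' hxs
    (fun y hy => EReal.toReal_le_toReal (hmin y) (hbot xs) hy) A hc hA z hlsc'
  refine ⟨p, hp, fun x => ?_, fun q hq => ?_⟩
  · by_cases hx : J x = ⊤
    · rw [proxObjective_adjoint_comp_self _ _ _ x, hx, EReal.top_add_coe]
      exact le_top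
    · rw [hobj p hpD, hobj x hx]
      exact_mod_cast hpmin x hx
  · have hqD : J q ≠ ⊤ := by
      intro h
      have h1 := hq xs
      rw [hobj xs hxs, proxObjective_adjoint_comp_self, h, EReal.top_add_coe, top_le_iff] at h1
      exact EReal.coe_ne_top _ h1
    refine huniq q hqD fun y hy => ?_
    have h1 := hq y
    rw [hobj q hqD, hobj y hy] at h1
    exact_mod_cast h1

end EReal

/-! ### Moore–Penrose inverses of operators bounded below -/

section MoorePenrose

variable {𝕜 X Y : Type*} [RCLike 𝕜]
  [NormedAddCommGroup X] [InnerProductSpace 𝕜 X] [CompleteSpace X]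
  [NormedAddCommGroup Y] [InnerProductSpace 𝕜 Y] [CompleteSpace Y]

/-- Cauchy–Schwarz on ‖Av‖² = Re⟨v, Hv⟩ bounds H below by c². Self-adjointness turns injectivity
into dense range, and the lower bound then gives bijectivity. -/
theorem isUnit_adjoint_comp_self (A : X →L[𝕜] Y) {c : ℝ} (hc : 0 < c)
    (hA : ∀ v, c * ‖v‖ ≤ ‖A v‖) : IsUnit (ContinuousLinearMap.adjoint A ∘L A) := by
  set H := ContinuousLinearMap.adjoint A ∘L A with hH
  have hbound : ∀ v, c ^ 2 * ‖v‖ ≤ ‖H v‖ := by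
    intro v
    rcases eq_or_ne v 0 with rfl | hv
    · simp
    have hv' : 0 < ‖v‖ := norm_pos_iff.2 hv
    have h1 : ‖A v‖ ^ 2 ≤ ‖v‖ * ‖H v‖ := by
      rw [← inner_self_eq_norm_sq (𝕜 := 𝕜), ← ContinuousLinearMap.adjoint_inner_right]
      exact (RCLike.re_le_norm _).trans (norm_inner_le_norm _ _)
    have h2 : (c * ‖v‖) ^ 2 ≤ ‖A v‖ ^ 2 := pow_le_pow_left₀ (by positivity) (hA v) 2
    refine le_of_mul_le_mul_left ?_ hv'
    nlinarith
  have hself : ContinuousLinearMap.adjoint H = H := by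
    rw [hH, ContinuousLinearMap.adjoint_comp, ContinuousLinearMap.adjoint_adjoint]
  have hinj : ∀ v, H v = 0 → v = 0 := by
    intro v hv
    have h := hbound v
    rw [hv, norm_zero] at h
    have : 0 < c ^ 2 := by positivity
    have : ‖v‖ ≤ 0 := by
      by_contra hne
      push Not at hne
      nlinarith [mul_pos this hne]
    exact norm_le_zero_iff.1 this
  have hanti : AntilipschitzWith (Real.toNNReal (c ^ 2)⁻¹) H := by
    refine ContinuousLinearMap.antilipschitz_of_bound _ fun v => ?_
    rw [Real.coe_toNNReal _ (by positivity), inv_mul_eq_div, le_div_iff₀ (by positivity), mul_comm]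
    exact hbound v
  have hbij : Function.Bijective H := by
    refine H.bijective_iff_dense_range_and_antilipschitz.2 ⟨?_, _, hanti⟩
    rw [Submodule.topologicalClosure_eq_top_iff, ContinuousLinearMap.orthogonal_range, hself,
      Submodule.eq_bot_iff]
    exact hinj
  let e := ContinuousLinearEquiv.ofBijective H (LinearMap.ker_eq_bot.2 hbij.1)
    (LinearMap.range_eq_top.2 hbij.2)
  exact ⟨ContinuousLinearEquiv.toUnit e, by ext v; rfl⟩

/-- AB and AC are self-adjoint and fix the range of A, so (AC)(AB) = AB; taking adjoints, AB =
(AB)(AC) = AC. Injectivity cancels A. -/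
theorem IsMoorePenrose.unique_of_injective {A : X →L[𝕜] Y} (hA : Function.Injective A)
    {B C : Y →L[𝕜] X} (hB : IsMoorePenrose A B) (hC : IsMoorePenrose A C) : B = C := by
  have h : A ∘L B = A ∘L C := by
    calc A ∘L B = ContinuousLinearMap.adjoint (A ∘L B) := hB.adjoint_left.symm
      _ = ContinuousLinearMap.adjoint ((A ∘L C) ∘L (A ∘L B)) := by
          congr 1
          conv_lhs => rw [← hC.mul_mul_left]
          rfl
      _ = (A ∘L B) ∘L (A ∘L C) := by
          rw [ContinuousLinearMap.adjoint_comp, hB.adjoint_left, hC.adjoint_left]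
      _ = (A ∘L B ∘L A) ∘L C := rfl
      _ = A ∘L C := by rw [hB.mul_mul_left]
  ext y
  exact hA (congrArg (fun T : Y →L[𝕜] Y => T y) h)

theorem existsUnique_isMoorePenrose (A : X →L[𝕜] Y) {c : ℝ} (hc : 0 < c)
    (hA : ∀ v, c * ‖v‖ ≤ ‖A v‖) : ∃! B, IsMoorePenrose A B := by
  obtain ⟨u, hu⟩ := isUnit_adjoint_comp_self A hc hA
  have hinv : (↑u⁻¹ : X →L[𝕜] X) ∘L (ContinuousLinearMap.adjoint A ∘L A) = 1 := by
    rw [← hu]; exact u.inv_mul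
  have hadj : ContinuousLinearMap.adjoint (↑u⁻¹ : X →L[𝕜] X) = ↑u⁻¹ := by
    have hsu : star u = u := by
      ext1
      rw [Units.coe_star, hu, ContinuousLinearMap.star_eq_adjoint,
        ContinuousLinearMap.adjoint_comp, ContinuousLinearMap.adjoint_adjoint]
    rw [← ContinuousLinearMap.star_eq_adjoint, ← Units.coe_star, star_inv, hsu]
  -- The witness is the least-squares inverse (A*A)⁻¹A*.
  set B : Y →L[𝕜] X := (↑u⁻¹ : X →L[𝕜] X) ∘L ContinuousLinearMap.adjoint A with hB
  have hBA : B ∘L A = 1 := by rw [hB, ContinuousLinearMap.comp_assoc, hinv]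
  have hMP : IsMoorePenrose A B := by
    refine ⟨by rw [hBA]; rfl, ?_, ?_, ?_⟩
    · rw [← ContinuousLinearMap.comp_assoc, hBA]; rfl
    · rw [hB, ContinuousLinearMap.adjoint_comp, ContinuousLinearMap.adjoint_comp,
        ContinuousLinearMap.adjoint_adjoint, hadj, ContinuousLinearMap.comp_assoc]
    · rw [hBA, ← ContinuousLinearMap.star_eq_adjoint, star_one]
  have hinj : Function.Injective A := by
    intro v w h
    have hleft : ∀ v, B (A v) = v := fun v => congrArg (fun T : X →L[𝕜] X => T v) hBA
    rw [← hleft v, h, hleft]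
  exact ⟨B, hMP, fun C hC => hC.unique_of_injective hinj hMP⟩

theorem isMoorePenrose_pinv {A : X →L[𝕜] Y} (h : ∃ B, IsMoorePenrose A B) :
    IsMoorePenrose A (pinv A) := by
  rw [pinv, dif_pos h]
  exact h.choose_spec

theorem IsMoorePenrose.comp_self_apply {A : X →L[𝕜] Y} {B : Y →L[𝕜] X}
    (h : IsMoorePenrose A B) (hA : Function.Injective A) (v : X) : B (A v) = v :=
  hA (congrArg (fun T : X →L[𝕜] Y => T v) h.mul_mul_left)

/-- `A A†` is a contraction. -/
theorem IsMoorePenrose.norm_self_comp_apply_le {A : X →L[𝕜] Y} {B : Y →L[𝕜] X}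
    (h : IsMoorePenrose A B) (y : Y) : ‖A (B y)‖ ≤ ‖y‖ := by
  have h1 : ‖A (B y)‖ ^ 2 ≤ ‖A (B y)‖ * ‖y‖ := by
    have h2 : inner 𝕜 (A (B y)) (A (B y)) = inner 𝕜 (A (B y)) y := by
      have h3 : A (B (A (B y))) = A (B y) :=
        congrArg (fun T : X →L[𝕜] Y => T (B y)) h.mul_mul_left
      have h4 := ContinuousLinearMap.adjoint_inner_right (A ∘L B) (A (B y)) y
      rw [h.adjoint_left] at h4
      simpa only [ContinuousLinearMap.comp_apply, h3] using h4
    rw [← inner_self_eq_norm_sq (𝕜 := 𝕜), h2]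
    exact (RCLike.re_le_norm _).trans (norm_inner_le_norm _ _)
  rcases (norm_nonneg (A (B y))).eq_or_lt with h0 | h0
  · rw [← h0]; exact norm_nonneg y
  · exact le_of_mul_le_mul_left (by rwa [← pow_two]) h0

theorem norm_le_norm_pinv_mul {A : X →L[𝕜] Y} (hinj : Function.Injective A)
    (hclosed : IsClosed (Set.range A)) (v : X) : ‖v‖ ≤ ‖pinv A‖ * ‖A v‖ := by
  obtain ⟨K, hK⟩ := A.antilipschitz_of_injective_of_isClosed_range hinj hclosed
  -- `K` may be 0, hence `K + 1`.
  have hbound : ∀ v, ((K : ℝ) + 1)⁻¹ * ‖v‖ ≤ ‖A v‖ := by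
    intro v
    have h := A.bound_of_antilipschitz hK v
    rw [inv_mul_le_iff₀ (by positivity)]
    nlinarith [norm_nonneg (A v)]
  have hMP := isMoorePenrose_pinv
    (existsUnique_isMoorePenrose A (by positivity : (0 : ℝ) < ((K : ℝ) + 1)⁻¹) hbound).exists
  calc ‖v‖ = ‖pinv A (A v)‖ := by rw [hMP.comp_self_apply hinj]
    _ ≤ _ := (pinv A).le_opNorm _

end MoorePenrose

/-! ### Linearization error -/

section Linearization

variable {𝕜 X Y : Type*} [RCLike 𝕜]
  [NormedAddCommGroup X] [NormedSpace 𝕜 X] [NormedAddCommGroup Y] [NormedSpace 𝕜 Y]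

/-- The error of the linearization at `x`, under a radial Lipschitz condition on the derivative
along the segment from `xs` to `x`. -/
theorem norm_fderiv_sub_le_of_radial_lipschitz {F : X → Y} {xs x : X} {M : ℝ}
    (hF : ∀ τ ∈ Set.Icc (0 : ℝ) 1, DifferentiableAt 𝕜 F (xs + (τ : 𝕜) • (x - xs)))
    (hM : ∀ τ ∈ Set.Icc (0 : ℝ) 1,
      ‖fderiv 𝕜 F x - fderiv 𝕜 F (xs + (τ : 𝕜) • (x - xs))‖ ≤ M * (1 - τ)) :
    ‖F x - F xs - fderiv 𝕜 F x (x - xs)‖ ≤ M / 2 * ‖x - xs‖ := by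
  let : NormedSpace ℝ Y := NormedSpace.restrictScalars ℝ 𝕜 Y
  have : IsScalarTower ℝ 𝕜 Y := IsScalarTower.restrictScalars ℝ 𝕜 Y
  set v := x - xs with hv
  have hderiv : ∀ τ ∈ Set.Icc (0 : ℝ) 1, HasDerivAt
      (fun t : ℝ => F (xs + (t : 𝕜) • v) - F xs - (t : 𝕜) • fderiv 𝕜 F x v)
      (fderiv 𝕜 F (xs + (τ : 𝕜) • v) v - fderiv 𝕜 F x v) τ := by
    intro τ hτ
    have hcoe : HasDerivAt (fun t : ℝ => (t : 𝕜)) 1 τ := by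
      simpa using (RCLike.ofRealCLM (K := 𝕜)).hasDerivAt (x := τ)
    have hline : HasDerivAt (fun s : 𝕜 => xs + s • v) v (τ : 𝕜) := by
      simpa using ((hasDerivAt_id (τ : 𝕜)).smul_const v).const_add xs
    have h1 : HasDerivAt (fun s : 𝕜 => F (xs + s • v) - F xs - s • fderiv 𝕜 F x v)
        (fderiv 𝕜 F (xs + (τ : 𝕜) • v) v - fderiv 𝕜 F x v) (τ : 𝕜) := by
      have h2 := (hF τ hτ).hasFDerivAt.comp_hasDerivAt (τ : 𝕜) hline
      have h3 := (hasDerivAt_id (τ : 𝕜)).smul_const (fderiv 𝕜 F x v)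
      convert! (h2.sub_const (F xs)).sub h3 using 1
      rw [one_smul]
    convert! HasDerivAt.scomp τ h1 hcoe using 1
    rw [one_smul]
  -- The barrier is the primitive of M‖v‖(1 - τ) vanishing at 0; its value at 1 gives the factor
  -- 1/2.
  have key := image_norm_le_of_norm_deriv_right_le_deriv_boundary (a := 0) (b := 1)
    (f := fun t : ℝ => F (xs + (t : 𝕜) • v) - F xs - (t : 𝕜) • fderiv 𝕜 F x v)
    (f' := fun τ => fderiv 𝕜 F (xs + (τ : 𝕜) • v) v - fderiv 𝕜 F x v)
    (B := fun τ => M * ‖v‖ * (τ - τ ^ 2 / 2)) (B' := fun τ => M * ‖v‖ * (1 - τ))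
    (fun τ hτ => (hderiv τ hτ).continuousAt.continuousWithinAt)
    (fun τ hτ => (hderiv τ (Set.Ico_subset_Icc_self hτ)).hasDerivWithinAt)
    (by simp) ?_ ?_ (Set.right_mem_Icc.2 zero_le_one)
  · have hx : xs + (1 : 𝕜) • v = x := by rw [hv, one_smul, add_sub_cancel]
    simp only [RCLike.ofReal_one, hx] at key
    rw [one_smul] at key
    linarith
  · intro τ
    have h := ((hasDerivAt_id τ).sub (((hasDerivAt_id τ).pow 2).div_const 2)).const_mul (M * ‖v‖)
    convert! h using 1
    norm_num
  · intro τ hτ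
    rw [← sub_apply]
    refine (ContinuousLinearMap.le_opNorm _ _).trans ?_
    rw [norm_sub_rev]
    calc _ ≤ M * (1 - τ) * ‖v‖ := by gcongr; exact hM τ (Set.Ico_subset_Icc_self hτ)
      _ = _ := by ring

end Linearization

/-! ### One proximal Gauss–Newton step -/

section GaussNewtonStep

variable {𝕜 X Y : Type*} [RCLike 𝕜]
  [NormedAddCommGroup X] [InnerProductSpace 𝕜 X] [CompleteSpace X]
  [NormedAddCommGroup Y] [InnerProductSpace 𝕜 Y] [CompleteSpace Y]

/-- A single proximal Gauss–Newton step from a point `x` whose distance `σ` to `xs` satisfies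
`2 L σ ≤ 1`. -/
theorem stepWellDefined_and_norm_prox_sub_le {Ω : Set X} (hΩ : IsOpen Ω)
    {J : X → EReal} (hJ : ProperFun J) (hconv : ConvexFun 𝕜 J)
    (hJlsc : LowerSemicontinuousOn J Ω)
    {F : X → Y} (hF : DifferentiableOn 𝕜 F Ω)
    {xs : X} (hFxs : F xs = 0) (hmin : ∀ y, J xs ≤ J y)
    {β L : ℝ} (hβ : 0 < β)
    (hinv : ∀ v, ‖v‖ ≤ β * ‖fderiv 𝕜 F xs v‖)
    {x : X} (hball : Metric.closedBall xs ‖x - xs‖ ⊆ Ω)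
    (hLip : ∀ τ ∈ Set.Icc (0 : ℝ) 1,
      β * ‖fderiv 𝕜 F x - fderiv 𝕜 F (xs + (τ : 𝕜) • (x - xs))‖ ≤ L * (1 - τ) * ‖x - xs‖)
    (hσ : 2 * (L * ‖x - xs‖) ≤ 1) :
    StepWellDefined 𝕜 F Ω J x ∧
      ‖prox 𝕜 J (gaussNewtonMetric 𝕜 F x) (gaussNewtonPoint 𝕜 F x) - xs‖ ≤
        L * ‖x - xs‖ ^ 2 / (2 * (1 - L * ‖x - xs‖)) := by
  set σ := ‖x - xs‖ with hσdef
  set A := fderiv 𝕜 F x with hAdef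
  have hσ0 : 0 ≤ σ := norm_nonneg _
  have hpos : 0 < 1 - L * σ := by linarith
  have hxΩ : x ∈ Ω := hball (by rw [Metric.mem_closedBall, dist_eq_norm])
  have hc : 0 < (1 - L * σ) / β := by positivity
  have hA : ∀ v, (1 - L * σ) / β * ‖v‖ ≤ ‖A v‖ := by
    intro v
    -- At τ = 0 the condition compares F'(x) with F'(x_*).
    have h0 := hLip 0 ⟨le_rfl, zero_le_one⟩
    rw [RCLike.ofReal_zero, zero_smul, add_zero] at h0
    have h1 := (A - fderiv 𝕜 F xs).le_opNorm v
    have h2 := mul_le_mul_of_nonneg_right h0 (norm_nonneg v)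
    have h3 : ‖fderiv 𝕜 F xs v‖ ≤ ‖A v‖ + ‖(A - fderiv 𝕜 F xs) v‖ := by
      have h4 : fderiv 𝕜 F xs v = A v - (A - fderiv 𝕜 F xs) v := by
        rw [sub_apply, sub_sub_cancel]
      rw [h4]
      exact norm_sub_le _ _
    have h5 := hinv v
    have h6 := mul_le_mul_of_nonneg_left h3 hβ.le
    have h7 := mul_le_mul_of_nonneg_left h1 hβ.le
    rw [div_mul_eq_mul_div, div_le_iff₀ hβ]
    linarith
  have hAinj : Function.Injective A := by
    refine (injective_iff_map_eq_zero A).2 fun v hv => ?_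
    have h := hA v
    rw [hv, norm_zero] at h
    exact norm_le_zero_iff.1 (nonpos_of_mul_nonpos_right h hc)
  have hMPex := existsUnique_isMoorePenrose A hc hA
  have hMP := isMoorePenrose_pinv hMPex.exists
  have hlin : ‖F x - F xs - A (x - xs)‖ ≤ L * σ / β / 2 * σ := by
    refine norm_fderiv_sub_le_of_radial_lipschitz (fun τ hτ => ?_) fun τ hτ => ?_
    · refine hF.differentiableAt (hΩ.mem_nhds (hball ?_))
      rw [Metric.mem_closedBall, dist_eq_norm, add_sub_cancel_left, norm_smul, RCLike.norm_ofReal,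
        abs_of_nonneg hτ.1]
      exact mul_le_of_le_one_left hσ0 hτ.2
    · have h := hLip τ hτ
      rw [div_mul_eq_mul_div, le_div_iff₀ hβ]
      linarith
  set z := gaussNewtonPoint 𝕜 F x with hz
  have hAz : ‖A (z - xs)‖ ≤ L * σ / β / 2 * σ := by
    have h1 : z - xs = -pinv A (F x - F xs - A (x - xs)) := by
      rw [hz, gaussNewtonPoint, map_sub, hMP.comp_self_apply hAinj, hFxs, sub_zero]
      abel
    rw [h1, map_neg, norm_neg]
    exact (hMP.norm_self_comp_apply_le _).trans hlin
  have hnear : ∀ p, ‖A (p - xs)‖ ≤ ‖A (z - xs)‖ →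
      ‖p - xs‖ ≤ L * σ ^ 2 / (2 * (1 - L * σ)) := by
    intro p hp
    have h := ((hA (p - xs)).trans hp).trans hAz
    have h1 : L * σ / β / 2 * σ = L * σ ^ 2 / 2 / β := by ring
    rw [h1, div_mul_eq_mul_div, div_le_div_iff_of_pos_right hβ] at h
    rw [le_div_iff₀ (by positivity)]
    linarith
  -- This keeps every candidate limit in the closed ball inside Ω, where J is semicontinuous.
  have hle : L * σ ^ 2 / (2 * (1 - L * σ)) ≤ σ := by
    rw [div_le_iff₀ (by positivity)]
    nlinarith
  obtain ⟨p, hp, hpprox, huniq⟩ := existsUnique_isProx hJ hconv hmin A hc hA z fun p hp => by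
    have hpΩ : p ∈ Ω := hball (by
      rw [Metric.mem_closedBall, dist_eq_norm]
      exact (hnear p hp).trans hle)
    intro c hc
    have h := hJlsc p hpΩ c hc
    rwa [hΩ.nhdsWithin_eq hpΩ] at h
  refine ⟨⟨hxΩ, hMPex, isUnit_adjoint_comp_self A hc hA, p, hpprox, huniq⟩, ?_⟩
  have hex : ∃ p, IsProx 𝕜 J (gaussNewtonMetric 𝕜 F x) z p := ⟨p, hpprox⟩
  rw [prox, dif_pos hex, huniq _ hex.choose_spec]
  exact hnear p hp

end GaussNewtonStep

/-! ### Radius and contraction constants -/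

section Radius

/-- (4 + κ)² - 8 ≥ (3 + κ)² as soon as 2κ ≥ 1. -/
theorem radius_le_half {κ : ℝ} (hκ : 1 ≤ κ) : (4 + κ - √((4 + κ) ^ 2 - 8)) / 2 ≤ 1 / 2 := by
  have h : 3 + κ ≤ √((4 + κ) ^ 2 - 8) := Real.le_sqrt_of_sq_le (by nlinarith)
  linarith

/-- Passes from the sharper κ-free bound to the stated constant: 1 - Lσ₀ ≤ κ + Lσ₀ because κ ≥ 1. -/
theorem step_factor_le {κ L σ σ₀ : ℝ} (hκ : 1 ≤ κ) (hL : 0 < L) (hσ : 0 ≤ σ) (hle : σ ≤ σ₀)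
    (hσ₀ : L * σ₀ < 1) :
    L * σ ^ 2 / (2 * (1 - L * σ)) ≤ (κ * L + L ^ 2 * σ₀) / (2 * (1 - L * σ₀) ^ 2) * σ ^ 2 := by
  have h0 : 0 < 1 - L * σ₀ := by linarith
  have h1 : L * σ ≤ L * σ₀ := by gcongr
  have h2 : 0 ≤ L * σ₀ := by nlinarith
  calc L * σ ^ 2 / (2 * (1 - L * σ)) ≤ L * σ ^ 2 / (2 * (1 - L * σ₀)) := by gcongr
    _ = L * (1 - L * σ₀) / (2 * (1 - L * σ₀) ^ 2) * σ ^ 2 := by field_simp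
    _ ≤ (κ * L + L ^ 2 * σ₀) / (2 * (1 - L * σ₀) ^ 2) * σ ^ 2 := by
      gcongr
      nlinarith

end Radius

end ProxGN

/-! ### Convergence of the iteration -/

theorem corollary4p3 {𝕜 X Y : Type*} [RCLike 𝕜]
    [NormedAddCommGroup X] [InnerProductSpace 𝕜 X] [CompleteSpace X]
    [NormedAddCommGroup Y] [InnerProductSpace 𝕜 Y] [CompleteSpace Y]
    (Ω : Set X) (hΩ : IsOpen Ω)
    (J : X → EReal) (hJproper : ProxGN.ProperFun J) (hJconvex : ProxGN.ConvexFun 𝕜 J)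
    (hJlsc : LowerSemicontinuousOn J Ω)
    (F : X → Y) (hF : ContDiffOn 𝕜 1 F Ω)
    (hclosed : ∀ x ∈ Ω, IsClosed (Set.range (fderiv 𝕜 F x)))
    (xs : X) (hxs : xs ∈ Ω) (R : ℝ) (hR : 0 < R)
    (β κ δ : ℝ)
    (hβ : β = ‖ProxGN.pinv (fderiv 𝕜 F xs)‖)
    (hκ : κ = β * ‖fderiv 𝕜 F xs‖)
    (hδ : δ = sSup {t : ℝ | t ∈ Set.Ico 0 R ∧ Metric.ball xs t ⊆ Ω})
    (hFxs : F xs = 0)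
    (hJxs : (0 : X) ∈ ProxGN.subdifferential 𝕜 J xs)
    (hinj : Function.Injective (fderiv 𝕜 F xs))
    (L : ℝ) (hL : 0 < L)
    (hLip : ∀ x ∈ Metric.ball xs δ, ∀ τ ∈ Set.Icc (0 : ℝ) 1,
      β * ‖fderiv 𝕜 F x - fderiv 𝕜 F (xs + (τ : 𝕜) • (x - xs))‖ ≤ L * (1 - τ) * ‖x - xs‖)
    (r : ℝ) (hr : r = min ((4 + κ - Real.sqrt ((4 + κ) ^ 2 - 8)) / (2 * L)) δ)
    (x₀ : X) (hx₀ : x₀ ∈ Metric.ball xs r \ {xs}) :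
    (∀ k, ProxGN.StepWellDefined 𝕜 F Ω J (ProxGN.proxGaussNewton 𝕜 F J x₀ k)) ∧
    (∀ k, ProxGN.proxGaussNewton 𝕜 F J x₀ k ∈ Metric.ball xs r) ∧
    Tendsto (ProxGN.proxGaussNewton 𝕜 F J x₀) atTop (𝓝 xs) ∧
    (∀ k, ‖ProxGN.proxGaussNewton 𝕜 F J x₀ (k + 1) - xs‖ ≤
      (κ * L + L ^ 2 * ‖x₀ - xs‖) / (2 * (1 - L * ‖x₀ - xs‖) ^ 2) *
        ‖ProxGN.proxGaussNewton 𝕜 F J x₀ k - xs‖ ^ 2) := by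
  obtain ⟨hx₀r, hx₀ne⟩ := hx₀
  rw [Metric.mem_ball, dist_eq_norm] at hx₀r
  have hd0 : 0 < ‖x₀ - xs‖ := norm_pos_iff.2 (sub_ne_zero.2 hx₀ne)
  have hinv : ∀ v, ‖v‖ ≤ β * ‖fderiv 𝕜 F xs v‖ := fun v =>
    hβ ▸ ProxGN.norm_le_norm_pinv_mul hinj (hclosed xs hxs) v
  -- The nonzero vector x₀ - x_* excludes β = 0, and below it also yields κ ≥ 1.
  have hβ0 : 0 < β := by
    refine lt_of_le_of_ne (hβ ▸ norm_nonneg _) fun h => ?_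
    have := hinv (x₀ - xs)
    rw [← h, zero_mul] at this
    linarith
  have hκ1 : 1 ≤ κ := by
    have h1 := hinv (x₀ - xs)
    have h2 := mul_le_mul_of_nonneg_left ((fderiv 𝕜 F xs).le_opNorm (x₀ - xs)) hβ0.le
    rw [← mul_assoc, ← hκ] at h2
    exact le_of_mul_le_mul_right (by linarith) hd0
  have hrδ : r ≤ δ := hr ▸ min_le_right _ _
  have hrL : L * r ≤ 1 / 2 := by
    have h1 : r ≤ (4 + κ - √((4 + κ) ^ 2 - 8)) / (2 * L) := hr ▸ min_le_left _ _
    rw [le_div_iff₀ (by positivity)] at h1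
    have h2 := ProxGN.radius_le_half hκ1
    linarith
  -- Below the supremum there is an admissible t > s, whose open ball contains the closed ball of
  -- radius s.
  have hδΩ : ∀ s < δ, Metric.closedBall xs s ⊆ Ω := by
    intro s hs y hy
    rw [hδ] at hs
    have hne : {t : ℝ | t ∈ Set.Ico 0 R ∧ Metric.ball xs t ⊆ Ω}.Nonempty :=
      ⟨0, ⟨le_rfl, hR⟩, by rw [Metric.ball_zero]; exact Set.empty_subset _⟩
    obtain ⟨t, ⟨-, ht⟩, hst⟩ := exists_lt_of_lt_csSup hne hs
    exact ht (lt_of_le_of_lt hy hst)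
  have hmin : ∀ y, J xs ≤ J y := by
    intro y
    simpa using hJxs y
  have hstep : ∀ x, ‖x - xs‖ < r → ProxGN.StepWellDefined 𝕜 F Ω J x ∧
      ‖ProxGN.prox 𝕜 J (ProxGN.gaussNewtonMetric 𝕜 F x) (ProxGN.gaussNewtonPoint 𝕜 F x) - xs‖ ≤
        L * ‖x - xs‖ ^ 2 / (2 * (1 - L * ‖x - xs‖)) := by
    intro x hx
    refine ProxGN.stepWellDefined_and_norm_prox_sub_le hΩ hJproper hJconvex hJlsc
      (hF.differentiableOn one_ne_zero) hFxs hmin hβ0 hinv (hδΩ _ (hx.trans_le hrδ))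
      (hLip x ?_) ?_
    · rw [Metric.mem_ball, dist_eq_norm]
      exact hx.trans_le hrδ
    · nlinarith
  set x := ProxGN.proxGaussNewton 𝕜 F J x₀ with hx
  have hsucc : ∀ k, ‖x k - xs‖ < r →
      ‖x (k + 1) - xs‖ ≤ L * ‖x k - xs‖ ^ 2 / (2 * (1 - L * ‖x k - xs‖)) :=
    fun k hk => (hstep (x k) hk).2
  -- Lσ ≤ 1/2 gives Lσ/(2(1 - Lσ)) ≤ 1/2.
  have hhalf : ∀ k, ‖x k - xs‖ < r → ‖x (k + 1) - xs‖ ≤ 1 / 2 * ‖x k - xs‖ := by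
    intro k hk
    refine (hsucc k hk).trans ?_
    have h1 : L * ‖x k - xs‖ ≤ 1 / 2 := by nlinarith
    have h2 := norm_nonneg (x k - xs)
    rw [div_le_iff₀ (by linarith)]
    nlinarith
  have hgeom : ∀ k, ‖x k - xs‖ ≤ (1 / 2) ^ k * ‖x₀ - xs‖ := by
    intro k
    induction k with
    | zero => simp [hx, ProxGN.proxGaussNewton]
    | succ k ih =>
      have h1 : ((1 : ℝ) / 2) ^ k ≤ 1 := pow_le_one₀ (by norm_num) (by norm_num)
      have h2 := hhalf k (by nlinarith)
      rw [pow_succ]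
      linarith
  have hle : ∀ k, ‖x k - xs‖ ≤ ‖x₀ - xs‖ := fun k =>
    (hgeom k).trans (mul_le_of_le_one_left hd0.le (pow_le_one₀ (by norm_num) (by norm_num)))
  have hlt : ∀ k, ‖x k - xs‖ < r := fun k => (hle k).trans_lt hx₀r
  refine ⟨fun k => (hstep _ (hlt k)).1, fun k => ?_, ?_, fun k => ?_⟩
  · rw [Metric.mem_ball, dist_eq_norm]
    exact hlt k
  · rw [tendsto_iff_norm_sub_tendsto_zero]
    refine squeeze_zero (fun k => norm_nonneg _) hgeom ?_
    simpa using (tendsto_pow_atTop_nhds_zero_of_lt_one (by norm_num : (0 : ℝ) ≤ 1 / 2)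
      (by norm_num)).mul_const ‖x₀ - xs‖
  · exact (hsucc k (hlt k)).trans
      (ProxGN.step_factor_le hκ1 hL (norm_nonneg _) (hle k) (by nlinarith))
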